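/- \textbf{Theorem.} Let $G$ be a countable discrete group and $f\in\mathbb{Z}(G)$, where $\mathbb{Z}(G)$ is the integral group ring. For $\xi\in\mathbb{R}^{G}$ and $\alpha=\sum_{h}\alpha_h h\in\mathbb{Z}(G)$ put \[(\alpha\xi)(g)=\sum_{h\in G}\alpha_h\,\xi(h^{-1}g),\qquad (\xi\alpha)(g)=\sum_{h\in G}\xi(gh^{-1})\,\alpha_h .\] Suppose that $f$ has an $\ell^{2}$ formal inverse $\xi$, that is, $\xi\in\ell^{2}(G,\mathbb{R})$ and $\xi f=\delta_{1}$. Suppose moreover that there is an $M\in\mathbb{N}$ such that for every $\alpha\in\mathbb{Z}(G)\setminus\mathbb{Z}(G)f$ there are $g_0\in G$ and an integer $k$ with $1\le k\le M$ and \[(\alpha\xi)(g_0)\in\tfrac1k\mathbb{Z}\setminus\mathbb{Z}.\] Let $X_f$ be the Pontryagin dual of the discrete abelian group $\mathbb{Z}(G)/\mathbb{Z}(G)f$, i.e. the compact group of homomorphisms $\chi\colon\mathbb{Z}(G)/\mathbb{Z}(G)f\to\mathbb{R}/\mathbb{Z}$, with its Haar probability measure $m_{X_f}$ and the action $(g\chi)(x)=\chi(g^{-1}x)$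 of $G$. Then $G\curvearrowright(X_f,m_{X_f})$ is a factor of a Bernoulli shift: there are a standard Borel probability space $(B,\beta)$ and a measurable map $\varphi\colon B^{G}\to X_f$ with $\varphi_{*}(\beta^{\otimes G})=m_{X_f}$ such that for every $g\in G$ one has $\varphi(gb)=g\varphi(b)$ for $\beta^{\otimes G}$-almost every $b\in B^{G}$, where $(gb)(h)=b(g^{-1}h)$. -/

import Mathlib

open MeasureTheory

namespace AlgebraicAction

noncomputable section

variable {G : Type*} [Group G]

/-- The real-valued function `ξ f` on `G`: `(ξ f)(g) = ∑ₕ ξ(g h⁻¹) f(h)`, a finite sum over the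
support of `f ∈ ℤ(G)`. -/
def convRight (ξ : G → ℝ) (f : MonoidAlgebra ℤ G) : G → ℝ :=
  fun g => ∑ h ∈ f.coeff.support, ξ (g * h⁻¹) * (f.coeff h : ℝ)

/-- The real-valued function `α ξ` on `G`: `(α ξ)(g) = ∑ₕ α(h) ξ(h⁻¹ g)`, a finite sum over the
support of `α ∈ ℤ(G)`. -/
def convLeft (α : MonoidAlgebra ℤ G) (ξ : G → ℝ) : G → ℝ :=
  fun g => ∑ h ∈ α.coeff.support, (α.coeff h : ℝ) * ξ (h⁻¹ * g)

open Classical in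
/-- `ξ` is an `ℓ²` formal inverse of `f`: it is square summable and `ξ f = δ₁`. -/
def IsL2FormalInverse (f : MonoidAlgebra ℤ G) (ξ : G → ℝ) : Prop :=
  Memℓp ξ 2 ∧ convRight ξ f = Pi.single 1 1

/-- The left `ℤ(G)`-module `ℤ(G) / ℤ(G)f`; the span in the ring `ℤ(G)` is the left ideal
generated by `f`. -/
abbrev CyclicModule (f : MonoidAlgebra ℤ G) : Type _ :=
  MonoidAlgebra ℤ G ⧸ Ideal.span {f}

/-- `ℤ(G) / ℤ(G)f` is a discrete group. -/
instance (f : MonoidAlgebra ℤ G) : TopologicalSpace (CyclicModule f) := ⊥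

instance (f : MonoidAlgebra ℤ G) : DiscreteTopology (CyclicModule f) := ⟨rfl⟩

/-- The compact abelian group `X_f`, the Pontryagin dual of `ℤ(G) / ℤ(G)f`: the continuous
homomorphisms into `ℝ/ℤ` with the compact-open topology. -/
abbrev DualGroup (f : MonoidAlgebra ℤ G) : Type _ :=
  CyclicModule f →ₜ+ UnitAddCircle

instance (f : MonoidAlgebra ℤ G) : MeasurableSpace (DualGroup f) := borel _

instance (f : MonoidAlgebra ℤ G) : BorelSpace (DualGroup f) := ⟨rfl⟩

/-- The Haar probability measure of `X_f`. -/
def haarX (f : MonoidAlgebra ℤ G) : Measure (DualGroup f) :=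
  Measure.addHaarMeasure ⊤

/-- The action of `G` on `X_f` dual to multiplication on `ℤ(G) / ℤ(G)f`:
`(g χ)(x) = χ(g⁻¹ x)`. -/
instance (f : MonoidAlgebra ℤ G) : MulAction G (DualGroup f) where
  smul g χ :=
    { toFun := fun x => χ (MonoidAlgebra.of ℤ G g⁻¹ • x)
      map_zero' := by rw [smul_zero, map_zero]
      map_add' := fun x y => by rw [smul_add, map_add]
      continuous_toFun := continuous_of_discreteTopology }
  one_smul χ := by
    ext x
    change χ (MonoidAlgebra.of ℤ G 1⁻¹ • x) = χ x
    rw [inv_one, map_one, one_smul]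
  mul_smul g h χ := by
    ext x
    change χ (MonoidAlgebra.of ℤ G (g * h)⁻¹ • x)
      = χ (MonoidAlgebra.of ℤ G h⁻¹ • MonoidAlgebra.of ℤ G g⁻¹ • x)
    rw [mul_inv_rev, map_mul, mul_smul]

/-- The shift action on `B^G`: `(g b)(h) = b(g⁻¹ h)`. -/
def shift {B : Type*} (g : G) (b : G → B) : G → B := fun h => b (g⁻¹ * h)

variable (G) in
/-- The action of `G` on the measure space `(X, μ)` is a factor of a Bernoulli shift: for some
standard probability space `(B, β)` there is a measurable map `B^G → X` that pushes `β^{⊗ G}`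
forward to `μ` and is almost everywhere `G`-equivariant. -/
def IsFactorOfBernoulli (X : Type*) [MeasurableSpace X] [MulAction G X] (μ : Measure X) : Prop :=
  ∃ (B : Type) (_ : MeasurableSpace B) (_ : StandardBorelSpace B) (β : Measure B)
    (_ : IsProbabilityMeasure β) (φ : (G → B) → X),
    MeasurePreserving φ (Measure.infinitePi fun _ : G => β) μ ∧
      ∀ g : G, ∀ᵐ b ∂(Measure.infinitePi fun _ : G => β), φ (shift g b) = g • φ b

end

end AlgebraicAction

namespace AlgebraicAction

noncomputable section

open ProbabilityTheory Filter Topology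
open scoped BoundedContinuousFunction

/-! ### Convolution on `ℓ²(G)`, and one-sided inverses. -/

section

/-! Take i.i.d. integer coordinates `b g`, centred and with finite variance. Then `η ↦ ∑ η(g) b(g)`
extends from finite sums to a bounded operator `T` from `ℓ²(G)` to `L²` of the Bernoulli measure
(`exists_ellTwo_toLp`), and `α ↦ T(α ξ) mod 1` is a random element of `X_f`. It kills `ℤ(G)f`
because `(a f) ξ = a (f ξ) = a` is integral and finitely supported. This uses `f ξ = δ₁`, whereas
the hypothesis is `ξ f = δ₁`; the passage between the two is direct finiteness
(`convLeftL_eq_single_of_convRightL_eq_single`). Equivariance holds because `T` intertwines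
translation with the shift (`toLp_shift`).

For the law, it suffices that every nontrivial character of `X_f` has mean zero. By independence,
the mean of `exp(2πi T(α ξ))` is a limit of finite products of values of the characteristic function
of the base at `2π (α ξ)(g)`. The base is chosen so that this function vanishes at `2π n/k` for
every nonintegral `n/k` with `k ≤ M`; the coordinate `g₀` then contributes a zero factor. -/

/-- The real Hilbert space `ℓ²(G)`. -/
abbrev EllTwo (G : Type*) : Type _ := lp (fun _ : G => ℝ) 2

theorem memℓp_two_comp_equiv {ι κ : Type*} (e : ι ≃ κ) {η : κ → ℝ} (hη : Memℓp η 2) :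
    Memℓp (fun i => η (e i)) 2 := by
  have h2 : 0 < (2 : ENNReal).toReal := by norm_num
  rw [memℓp_gen_iff h2] at hη ⊢
  exact e.summable_iff.2 hη

/-- Precomposition with a permutation of the index set, as an isometry of `ℓ²`. -/
def permute {ι : Type*} (e : ι ≃ ι) : EllTwo ι →ₗᵢ[ℝ] EllTwo ι where
  toFun η := ⟨fun i => η (e i), memℓp_two_comp_equiv e (lp.memℓp η)⟩
  map_add' _ _ := rfl
  map_smul' _ _ := rfl
  norm_map' η := by
    have h2 : 0 < (2 : ENNReal).toReal := by norm_num
    rw [lp.norm_eq_tsum_rpow h2, lp.norm_eq_tsum_rpow h2]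
    congr 1
    exact e.tsum_eq fun i => ‖η i‖ ^ (2 : ENNReal).toReal

@[simp]
theorem permute_apply {ι : Type*} (e : ι ≃ ι) (η : EllTwo ι) (i : ι) :
    permute e η i = η (e i) := rfl

open Classical in
theorem permute_single {ι : Type*} (e : ι ≃ ι) (i : ι) (c : ℝ) :
    permute e (lp.single 2 i c : EllTwo ι) = lp.single 2 (e.symm i) c := by
  ext j
  simp only [permute_apply, lp.single_apply, Pi.single_apply, Equiv.eq_symm_apply]

theorem ellTwo_inner_eq_tsum {ι : Type*} (η ζ : EllTwo ι) :
    inner ℝ η ζ = ∑' i, η i * ζ i := by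
  rw [lp.inner_eq_tsum]
  exact tsum_congr fun i => by simp [mul_comm]

theorem inner_permute {ι : Type*} (e : ι ≃ ι) (η ζ : EllTwo ι) :
    inner ℝ (permute e η) ζ = inner ℝ η (permute e.symm ζ) := by
  rw [ellTwo_inner_eq_tsum, ellTwo_inner_eq_tsum, ← e.symm.tsum_eq]
  exact tsum_congr fun i => by simp

open Classical in
theorem inner_single_one {ι : Type*} (η : EllTwo ι) (i : ι) :
    inner ℝ (lp.single 2 i (1 : ℝ)) η = η i := by
  rw [lp.inner_single_left]; simp

variable {G : Type*} [Group G]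

/-- Left convolution by `α ∈ ℤ(G)` on `ℓ²(G)`. -/
def convLeftL (α : MonoidAlgebra ℤ G) : EllTwo G →L[ℝ] EllTwo G :=
  ∑ h ∈ α.coeff.support,
    (α.coeff h : ℝ) • (permute (Equiv.mulLeft h⁻¹)).toContinuousLinearMap

/-- Right convolution by `f ∈ ℤ(G)` on `ℓ²(G)`. -/
def convRightL (f : MonoidAlgebra ℤ G) : EllTwo G →L[ℝ] EllTwo G :=
  ∑ h ∈ f.coeff.support,
    (f.coeff h : ℝ) • (permute (Equiv.mulRight h⁻¹)).toContinuousLinearMap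

theorem coe_convLeftL (α : MonoidAlgebra ℤ G) (η : EllTwo G) :
    ⇑(convLeftL α η) = convLeft α η := by
  ext g
  simp only [convLeftL, convLeft, sum_apply, lp.coeFn_sum, Finset.sum_apply]
  rfl

theorem coe_convRightL (f : MonoidAlgebra ℤ G) (η : EllTwo G) :
    ⇑(convRightL f η) = convRight η f := by
  ext g
  simp only [convRightL, convRight, sum_apply, lp.coeFn_sum, Finset.sum_apply]
  refine Finset.sum_congr rfl fun h _ => ?_
  exact mul_comm _ _

theorem convLeftL_apply (α : MonoidAlgebra ℤ G) (η : EllTwo G) (g : G) :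
    convLeftL α η g = ∑ h ∈ α.coeff.support, (α.coeff h : ℝ) * η (h⁻¹ * g) := by
  rw [coe_convLeftL]; rfl

theorem convRightL_apply (f : MonoidAlgebra ℤ G) (η : EllTwo G) (g : G) :
    convRightL f η g = ∑ h ∈ f.coeff.support, η (g * h⁻¹) * (f.coeff h : ℝ) := by
  rw [coe_convRightL]; rfl

theorem convLeftL_convRightL (α f : MonoidAlgebra ℤ G) (η : EllTwo G) :
    convLeftL α (convRightL f η) = convRightL f (convLeftL α η) := by
  ext g
  rw [convLeftL_apply, convRightL_apply]
  simp only [convLeftL_apply, convRightL_apply, Finset.mul_sum, Finset.sum_mul]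
  rw [Finset.sum_comm]
  simp only [mul_assoc]

theorem permute_mulLeft_convRightL (g : G) (f : MonoidAlgebra ℤ G) (η : EllTwo G) :
    permute (Equiv.mulLeft g) (convRightL f η) = convRightL f (permute (Equiv.mulLeft g) η) := by
  ext x
  rw [permute_apply, coe_convRightL, coe_convRightL]
  simp [convRight, mul_assoc]

theorem convLeftL_eq_sum (α : MonoidAlgebra ℤ G) (η : EllTwo G) {s : Finset G}
    (hs : α.coeff.support ⊆ s) :
    convLeftL α η = ∑ h ∈ s, (α.coeff h : ℝ) • permute (Equiv.mulLeft h⁻¹) η := by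
  rw [convLeftL, sum_apply]
  refine Finset.sum_subset hs fun h _ hh => ?_
  simp [Finsupp.notMem_support_iff.1 hh]

theorem convLeftL_add (α β : MonoidAlgebra ℤ G) (η : EllTwo G) :
    convLeftL (α + β) η = convLeftL α η + convLeftL β η := by
  classical
  have h1 : (α + β).coeff.support ⊆ α.coeff.support ∪ β.coeff.support := Finsupp.support_add
  rw [convLeftL_eq_sum _ _ h1, convLeftL_eq_sum α η Finset.subset_union_left,
    convLeftL_eq_sum β η Finset.subset_union_right, ← Finset.sum_add_distrib]
  refine Finset.sum_congr rfl fun h _ => ?_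
  rw [← add_smul]
  congr 1
  exact Int.cast_add _ _

theorem convLeftL_single (g : G) (n : ℤ) (η : EllTwo G) :
    convLeftL (MonoidAlgebra.single g n) η = (n : ℝ) • permute (Equiv.mulLeft g⁻¹) η := by
  classical
  have h1 : (MonoidAlgebra.single g n : MonoidAlgebra ℤ G).coeff.support ⊆ {g} :=
    Finsupp.support_single_subset
  rw [convLeftL_eq_sum _ _ h1, Finset.sum_singleton]
  simp

theorem convLeftL_mul (α β : MonoidAlgebra ℤ G) (η : EllTwo G) :
    convLeftL (α * β) η = convLeftL α (convLeftL β η) := by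
  induction α using MonoidAlgebra.induction_linear with
  | zero => simp [convLeftL]
  | add a b ha hb => rw [add_mul, convLeftL_add, ha, hb, convLeftL_add]
  | single g m =>
    induction β using MonoidAlgebra.induction_linear with
    | zero => simp [convLeftL]
    | add a b ha hb => rw [mul_add, convLeftL_add, ha, hb, convLeftL_add, map_add]
    | single h n =>
      rw [MonoidAlgebra.single_mul_single, convLeftL_single, convLeftL_single, convLeftL_single]
      ext x
      simp [mul_assoc]

open Classical in
theorem convLeftL_apply_single (α : MonoidAlgebra ℤ G) :
    convLeftL α (lp.single 2 1 (1 : ℝ))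
      = ∑ h ∈ α.coeff.support, (α.coeff h : ℝ) • lp.single 2 h (1 : ℝ) := by
  rw [convLeftL, sum_apply]
  refine Finset.sum_congr rfl fun h _ => ?_
  simp [permute_single]

open Classical in
/-- A right inverse in `ℓ²(G)` of an element of `ℤ(G)` is also a left inverse. -/
theorem convLeftL_eq_single_of_convRightL_eq_single (f : MonoidAlgebra ℤ G) (ξ : EllTwo G)
    (hξ : convRightL f ξ = lp.single 2 1 (1 : ℝ)) :
    convLeftL f ξ = lp.single 2 1 (1 : ℝ) := by
  set δ : EllTwo G := lp.single 2 1 (1 : ℝ) with hδ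
  -- `f ξ - δ` will lie in this kernel, so the aim is `K = 0`. The projection onto `K` commutes with
  -- left translations, hence is determined by `p = P δ`, and `p = 0` suffices.
  let K : Submodule ℝ (EllTwo G) := LinearMap.ker (convRightL f).toLinearMap
  have hK (η : EllTwo G) : η ∈ K ↔ convRightL f η = 0 := LinearMap.mem_ker
  have : CompleteSpace K := (convRightL f).isClosed_ker.completeSpace_coe
  let P : EllTwo G → EllTwo G := fun η => K.starProjection η
  have hPK (η) : convRightL f (P η) = 0 := (hK _).1 (K.starProjection_apply_mem η)
  have hPfix (η) (h : convRightL f η = 0) : P η = η :=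
    Submodule.starProjection_eq_self_iff.2 ((hK η).2 h)
  have hPsymm (η ζ) : inner ℝ (P η) ζ = inner ℝ η (P ζ) :=
    Submodule.inner_starProjection_left_eq_right K η ζ
  have hPtrans (g : G) (η) : P (permute (Equiv.mulLeft g) η) = permute (Equiv.mulLeft g) (P η) := by
    refine Submodule.eq_starProjection_of_mem_of_inner_eq_zero ?_ ?_
    · rw [hK, ← permute_mulLeft_convRightL, hPK, map_zero]
    · intro w hw
      rw [← map_sub, inner_permute]
      refine K.starProjection_inner_eq_zero η _ ?_
      rw [hK] at hw ⊢
      have : (Equiv.mulLeft g).symm = Equiv.mulLeft g⁻¹ := by ext; simp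
      rw [this, ← permute_mulLeft_convRightL, hw, map_zero]
  set p : EllTwo G := P δ with hp
  have hPs (g : G) : P (lp.single 2 g (1 : ℝ)) = permute (Equiv.mulLeft g⁻¹) p := by
    rw [hp, ← hPtrans, hδ, permute_single]
    simp
  -- Self-adjointness of `P`: `p g = ⟪P δ, δ_g⟫ = ⟪δ, P δ_g⟫`, the value at `1` of a translate of
  -- `p`.
  have hpsymm (g : G) : p g⁻¹ = p g := by
    have h1 : p g = inner ℝ δ (P (lp.single 2 g (1 : ℝ))) := by
      rw [← hPsymm, ← hp, real_inner_comm, inner_single_one]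
    rw [h1, hPs, hδ, inner_single_one, permute_apply]
    simp
  have hpf : convRight p f = 0 := by rw [← coe_convRightL, hPK]; rfl
  -- the pairing of `p` with `f ξ` vanishes
  have h1 : inner ℝ (convLeftL f ξ) p = 0 := by
    have h2 : inner ℝ (convLeftL f ξ) p
        = inner ℝ ξ (∑ h ∈ f.coeff.support, (f.coeff h : ℝ) • permute (Equiv.mulLeft h) p) := by
      rw [convLeftL, sum_apply, sum_inner, inner_sum]
      refine Finset.sum_congr rfl fun h _ => ?_
      have : (Equiv.mulLeft h⁻¹).symm = Equiv.mulLeft h := by ext; simp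
      simp only [smul_apply, LinearIsometry.coe_toContinuousLinearMap]
      rw [real_inner_smul_left, real_inner_smul_right, inner_permute, this]
    -- By the symmetry of `p`, the value of this sum at `k` is `(p f)(k⁻¹)`.
    have h3 : (∑ h ∈ f.coeff.support, (f.coeff h : ℝ) • permute (Equiv.mulLeft h) p) = 0 := by
      ext k
      have h4 := congrFun hpf k⁻¹
      rw [lp.coeFn_sum, Finset.sum_apply]
      refine Eq.trans (Finset.sum_congr rfl fun h _ => ?_) h4
      rw [← mul_inv_rev, hpsymm]
      exact mul_comm _ _
    rw [h2, h3, inner_zero_right]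
  have hker : convRightL f (convLeftL f ξ - δ) = 0 := by
    rw [map_sub, ← convLeftL_convRightL, hξ, sub_eq_zero]
    ext g
    rw [coe_convLeftL, coe_convRightL]
    simp only [convLeft, convRight, hδ, lp.single_apply, Pi.single_apply]
    refine Finset.sum_congr rfl fun h _ => ?_
    rw [mul_comm]
    congr 1
    refine if_congr ?_ rfl rfl
    rw [inv_mul_eq_one, mul_inv_eq_one, eq_comm]
  -- The trace property: `f ξ` and `ξ f` agree at the identity.
  have hone : convLeft f ξ 1 = 1 := by
    have h5 : convRight ξ f 1 = 1 := by
      rw [← coe_convRightL, hξ]; simp [hδ]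
    rw [← h5]
    simp [convLeft, convRight, mul_comm]
  -- On `K`, pairing with `p` is evaluation at `1`. Together with `h1` this gives `⟪δ, p⟫ = 0`,
  -- which is `‖p‖²`.
  have h6 : inner ℝ (convLeftL f ξ - δ) p = 0 := by
    rw [hp, ← hPsymm, hPfix _ hker, real_inner_comm, hδ, inner_single_one, lp.coeFn_sub,
      Pi.sub_apply, coe_convLeftL, hone]
    simp
  have hp0 : p = 0 := by
    rw [← inner_self_eq_zero (𝕜 := ℝ)]
    rw [inner_sub_left, h1, zero_sub, neg_eq_zero] at h6
    calc inner ℝ p p = inner ℝ δ (P p) := hPsymm δ p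
      _ = 0 := by rw [hPfix p (hPK δ), h6]
  have h7 (η : EllTwo G) (h : convRightL f η = 0) : η = 0 := by
    ext g
    rw [← inner_single_one, ← hPfix η h, ← hPsymm, hPs, hp0]
    simp
  exact sub_eq_zero.1 (h7 _ hker)

end

/-! ### The base measure on `ℤ`. -/

section

/-- A geometric sum whose ratio is an `N`-th root of unity other than `1`. -/
theorem sum_fin_exp_eq_zero {N k : ℕ} (hk : 1 ≤ k) (hkN : k ∣ N) (n : ℤ)
    (hn : ¬ ∃ m : ℤ, (n : ℝ) / k = m) :
    ∑ i : Fin N, Complex.exp (2 * Real.pi * (n / k : ℝ) * i * Complex.I) = 0 := by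
  have hk0 : (k : ℂ) ≠ 0 := by exact_mod_cast (by omega : k ≠ 0)
  have hk0' : (k : ℝ) ≠ 0 := by exact_mod_cast (by omega : k ≠ 0)
  have hpi : (2 * Real.pi * Complex.I : ℂ) ≠ 0 := Complex.two_pi_I_ne_zero
  set z : ℂ := Complex.exp (2 * Real.pi * (n / k : ℝ) * Complex.I) with hz
  have hz1 : z ≠ 1 := by
    intro h
    obtain ⟨m, hm⟩ := Complex.exp_eq_one_iff.1 h
    refine hn ⟨m, ?_⟩
    have h1 : ((n / k : ℝ) : ℂ) = m := by
      apply mul_right_cancel₀ hpi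
      rw [← hm]; ring
    exact_mod_cast h1
  have hzN : z ^ N = 1 := by
    obtain ⟨q, rfl⟩ := hkN
    rw [hz, ← Complex.exp_nat_mul, Complex.exp_eq_one_iff]
    refine ⟨q * n, ?_⟩
    push_cast
    field_simp
  have h3 : ∑ i ∈ Finset.range N, z ^ i = 0 := by
    have := geom_sum_mul z N
    rw [hzN, sub_self] at this
    exact (mul_eq_zero.1 this).resolve_right (sub_ne_zero.2 hz1)
  rw [← h3, ← Fin.sum_univ_eq_sum_range]
  refine Finset.sum_congr rfl fun i _ => ?_
  rw [hz, ← Complex.exp_nat_mul]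
  congr 1; ring

/-- There is a bounded centred non-degenerate integer-valued distribution whose characteristic
function vanishes at all non-integral rationals of denominator at most `M`. -/
theorem exists_measure_int_charFun_eq_zero (M : ℕ) :
    ∃ β : Measure ℤ, IsProbabilityMeasure β ∧ MemLp (fun n : ℤ => (n : ℝ)) 2 β ∧
      ∫ n : ℤ, (n : ℝ) ∂β = 0 ∧ ∫ n : ℤ, (n : ℝ) * n ∂β ≠ 0 ∧
      ∀ k : ℕ, 1 ≤ k → k ≤ M → ∀ n : ℤ, (¬ ∃ m : ℤ, (n : ℝ) / k = m) →
        ∫ x : ℤ, Complex.exp (2 * Real.pi * (n / k : ℝ) * x * Complex.I) ∂β = 0 := by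
  obtain ⟨N, hN2, hN⟩ : ∃ N : ℕ, 2 ≤ N ∧ ∀ k : ℕ, 1 ≤ k → k ≤ M → k ∣ N :=
    -- The shift by `2` forces `N ≥ 2` even for small `M`, so that the variance is nonzero.
    ⟨(M + 2).factorial, (Nat.self_le_factorial _).trans' (by omega),
      fun k h1 h2 => Nat.dvd_factorial h1 (by omega)⟩
  have : NeZero N := ⟨by omega⟩
  let ν : Measure (Fin N × Fin N) := (PMF.uniformOfFintype (Fin N × Fin N)).toMeasure
  -- A difference of two independent uniform variables is centred, and its characteristic function
  -- keeps the zeros of the uniform one as a factor.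
  let D : Fin N × Fin N → ℤ := fun p => (p.1 : ℤ) - (p.2 : ℤ)
  have hD : Measurable D := measurable_of_finite D
  have hint {E : Type} [NormedAddCommGroup E] [NormedSpace ℝ E] [CompleteSpace E] (F : ℤ → E) :
      ∫ n, F n ∂(ν.map D) = ((N * N : ℝ)⁻¹) • ∑ i : Fin N, ∑ j : Fin N, F (i - j) := by
    rw [integral_map hD.aemeasurable (by fun_prop), PMF.integral_eq_sum, Fintype.sum_prod_type]
    simp [D, Finset.smul_sum]
  refine ⟨ν.map D, Measure.isProbabilityMeasure_map hD.aemeasurable, ?_, ?_, ?_, ?_⟩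
  · rw [memLp_map_measure_iff (by fun_prop) hD.aemeasurable]
    exact MemLp.of_discrete
  · rw [hint, smul_eq_mul]
    refine mul_eq_zero_of_right _ ?_
    simp [Finset.sum_sub_distrib, ← Finset.mul_sum]
  · rw [hint, smul_eq_mul]
    refine mul_ne_zero (by simp; omega) (ne_of_gt ?_)
    refine Finset.sum_pos' (fun i _ => Finset.sum_nonneg fun j _ => mul_self_nonneg _)
      ⟨⟨1, by omega⟩, Finset.mem_univ _, ?_⟩
    refine Finset.sum_pos' (fun j _ => mul_self_nonneg _) ⟨⟨0, by omega⟩, Finset.mem_univ _, ?_⟩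
    simp
  · intro k hk1 hkM n hn
    rw [hint]
    refine smul_eq_zero_of_right _ ?_
    have h1 := sum_fin_exp_eq_zero hk1 (hN k hk1 hkM) n hn
    have h2 (i j : Fin N) : Complex.exp (2 * Real.pi * (n / k : ℝ) * ((i - j : ℤ) : ℂ) * Complex.I)
        = Complex.exp (2 * Real.pi * (n / k : ℝ) * i * Complex.I)
          * Complex.exp (- (2 * Real.pi * (n / k : ℝ) * j * Complex.I)) := by
      rw [← Complex.exp_add]
      congr 1
      push_cast; ring
    simp_rw [h2, ← Finset.mul_sum]
    rw [← Finset.sum_mul, h1, zero_mul]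

end

/-! ### The Bernoulli measure and the operator `T`. -/

section

variable {G : Type*} [Group G]

theorem measurePreserving_shift {B : Type*} [MeasurableSpace B] (β : Measure B)
    [IsProbabilityMeasure β] (g : G) :
    MeasurePreserving (shift (B := B) g) (Measure.infinitePi fun _ : G => β)
      (Measure.infinitePi fun _ : G => β) := by
  refine ⟨by unfold shift; fun_prop, ?_⟩
  have h := Measure.infinitePi_map_piCongrLeft (fun _ : G => β) (Equiv.mulLeft g)
  refine Eq.trans ?_ h
  congr 1
  ext b x
  rw [MeasurableEquiv.coe_piCongrLeft, ← (Equiv.mulLeft g).apply_symm_apply x,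
    Equiv.piCongrLeft_apply_apply]
  simp [shift]

/-- The measure of the Bernoulli shift over `G` with base `(ℤ, β)`. -/
abbrev bernoulli (G : Type*) (β : Measure ℤ) : Measure (G → ℤ) :=
  Measure.infinitePi fun _ : G => β

theorem measurePreserving_eval_bernoulli {ι : Type*} (β : Measure ℤ) [IsProbabilityMeasure β]
    (i : ι) : MeasurePreserving (fun b : ι → ℤ => b i) (bernoulli ι β) β :=
  measurePreserving_eval_infinitePi _ i

theorem measurable_eval_intCast {ι : Type*} (i : ι) :
    Measurable fun b : ι → ℤ => (b i : ℝ) :=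
  (measurable_of_countable fun n : ℤ => (n : ℝ)).comp (measurable_pi_apply i)

theorem integral_bernoulli_eval {ι E : Type*} [NormedAddCommGroup E] [NormedSpace ℝ E]
    [SecondCountableTopology E] [MeasurableSpace E] [BorelSpace E]
    (β : Measure ℤ) [IsProbabilityMeasure β] (i : ι) (F : ℤ → E) :
    ∫ b, F (b i) ∂(bernoulli ι β) = ∫ n, F n ∂β := by
  have h := measurePreserving_eval_bernoulli β i
  have h1 := integral_map (f := F) h.aemeasurable (measurable_of_countable F).aestronglyMeasurable
  rw [h.map_eq] at h1
  exact h1.symm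

open Classical in
theorem toLp_sum_single {ι : Type*} {β : Measure ℤ}
    {T : EllTwo ι →L[ℝ] Lp ℝ 2 (bernoulli ι β)}
    (hT : ∀ g, T (lp.single 2 g (1 : ℝ)) =ᵐ[bernoulli ι β]
        fun b => (b g : ℝ)) (s : Finset ι) (c : ι → ℝ) :
    T (∑ h ∈ s, c h • lp.single 2 h (1 : ℝ)) =ᵐ[bernoulli ι β]
      fun b => ∑ h ∈ s, c h * b h := by
  induction s using Finset.induction with
  | empty =>
    simp only [Finset.sum_empty, map_zero]
    exact Lp.coeFn_zero _ _ _
  | insert a s ha ih =>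
    rw [Finset.sum_insert ha, map_add, map_smul]
    filter_upwards [Lp.coeFn_add (c a • T (lp.single 2 a (1 : ℝ)))
      (T (∑ h ∈ s, c h • lp.single 2 h (1 : ℝ))), Lp.coeFn_smul (c a) (T (lp.single 2 a (1 : ℝ))),
      ih, hT a] with b h1 h2 h3 h4
    rw [h1, Pi.add_apply, h2, Pi.smul_apply, h3, h4, Finset.sum_insert ha, smul_eq_mul]

open Classical in
/-- A centred non-degenerate distribution on `ℤ` gives a bounded operator from `ℓ²(ι)` to the
`L²` space of the Bernoulli shift that maps `δ_g` to the `g`-th coordinate. -/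
theorem exists_ellTwo_toLp {ι : Type*} {β : Measure ℤ} [IsProbabilityMeasure β]
    (h2 : MemLp (fun n : ℤ => (n : ℝ)) 2 β) (h0 : ∫ n : ℤ, (n : ℝ) ∂β = 0)
    (hne : ∫ n : ℤ, (n : ℝ) * n ∂β ≠ 0) :
    ∃ T : EllTwo ι →L[ℝ] Lp ℝ 2 (bernoulli ι β),
      ∀ g, T (lp.single 2 g (1 : ℝ)) =ᵐ[bernoulli ι β]
        fun b => (b g : ℝ) := by
  have hev (g : ι) := measurePreserving_eval_bernoulli β g
  have hmem (g : ι) : MemLp (fun b : ι → ℤ => (b g : ℝ)) 2 (bernoulli ι β) :=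
    h2.comp_measurePreserving (hev g)
  let X : ι → Lp ℝ 2 (bernoulli ι β) := fun g => (hmem g).toLp
  have hinner (g h : ι) : inner ℝ (X g) (X h) = ∫ b, (b g : ℝ) * b h ∂(bernoulli ι β) := by
    rw [L2.inner_def]
    refine integral_congr_ae ?_
    filter_upwards [(hmem g).coeFn_toLp, (hmem h).coeFn_toLp] with b hg hh
    rw [hg, hh]
    exact mul_comm _ _
  set v : ℝ := ∫ n : ℤ, (n : ℝ) * n ∂β with hv
  have hvpos : 0 < v :=
    lt_of_le_of_ne (integral_nonneg fun n => mul_self_nonneg _) (Ne.symm hne)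
  have hdiag (g : ι) : inner ℝ (X g) (X g) = v := by
    rw [hinner]
    exact integral_bernoulli_eval β g fun n : ℤ => (n : ℝ) * n
  have hoff (g h : ι) (hgh : g ≠ h) : inner ℝ (X g) (X h) = 0 := by
    rw [hinner]
    have hind : iIndepFun (fun (g : ι) (b : ι → ℤ) => (b g : ℝ)) (bernoulli ι β) :=
      iIndepFun_infinitePi (X := fun _ (n : ℤ) => (n : ℝ)) fun _ => by fun_prop
    rw [(hind.indepFun hgh).integral_fun_mul_eq_mul_integral (hmem g).1 (hmem h).1]
    rw [integral_bernoulli_eval β g fun n : ℤ => (n : ℝ), h0, zero_mul]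
  have hortho : Orthonormal ℝ fun g => (√v)⁻¹ • X g := by
    rw [orthonormal_iff_ite]
    intro g h
    rw [real_inner_smul_left, real_inner_smul_right]
    split_ifs with hgh
    · subst hgh
      rw [hdiag, ← mul_assoc, ← mul_inv, Real.mul_self_sqrt hvpos.le, inv_mul_cancel₀ hne]
    · rw [hoff g h hgh, mul_zero, mul_zero]
  refine ⟨√v • hortho.orthogonalFamily.linearIsometry.toContinuousLinearMap, fun g => ?_⟩
  have : (√v • hortho.orthogonalFamily.linearIsometry.toContinuousLinearMap)
      (lp.single 2 g (1 : ℝ)) = X g := by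
    rw [smul_apply, LinearIsometry.coe_toContinuousLinearMap,
      OrthogonalFamily.linearIsometry_apply_single]
    simp [smul_smul, mul_inv_cancel₀ (Real.sqrt_ne_zero'.2 hvpos)]
  rw [this]
  exact (hmem g).coeFn_toLp

variable {β : Measure ℤ} [IsProbabilityMeasure β]

-- Both sides are continuous and linear in `η`, so it is enough to compare them on `δ_h`, where both
-- give the coordinate `g⁻¹ h`.
open Classical in
theorem toLp_shift {T : EllTwo G →L[ℝ] Lp ℝ 2 (bernoulli G β)}
    (hT : ∀ g, T (lp.single 2 g (1 : ℝ)) =ᵐ[bernoulli G β]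
        fun b => (b g : ℝ)) (g : G) (η : EllTwo G) :
    (fun b => T η (shift g b)) =ᵐ[bernoulli G β]
      T (permute (Equiv.mulLeft g) η) := by
  have hg := measurePreserving_shift β g
  let U : Lp ℝ 2 (bernoulli G β) →L[ℝ] Lp ℝ 2 (bernoulli G β) :=
    (Lp.compMeasurePreservingₗᵢ ℝ (shift g) hg).toContinuousLinearMap
  have hU (Y : Lp ℝ 2 (bernoulli G β)) : U Y =ᵐ[bernoulli G β] Y ∘ shift g :=
    Lp.coeFn_compMeasurePreserving Y hg
  have hsingle (h : G) : U (T (lp.single 2 h (1 : ℝ)))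
      = T (permute (Equiv.mulLeft g) (lp.single 2 h (1 : ℝ))) := by
    apply Lp.ext
    rw [permute_single]
    filter_upwards [hU (T (lp.single 2 h (1 : ℝ))), hg.quasiMeasurePreserving.ae (hT h),
      hT ((Equiv.mulLeft g).symm h)] with b h1 h2 h3
    rw [h1, h3, Function.comp_apply, h2]
    simp [shift]
  have hall : U (T η) = T (permute (Equiv.mulLeft g) η) := by
    have h1 := lp.hasSum_single (by norm_num : (2 : ENNReal) ≠ ⊤) η
    have h2 := h1.mapL (U ∘L T)
    have h3 := h1.mapL (T ∘L (permute (Equiv.mulLeft g)).toContinuousLinearMap)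
    refine h2.unique (h3.congr_fun fun h => ?_)
    have h4 : (lp.single 2 h (η h) : EllTwo G) = η h • lp.single 2 h (1 : ℝ) := by
      rw [← lp.single_smul]; simp
    rw [h4, map_smul, map_smul]
    congr 1
    exact hsingle h
  rw [← hall]
  exact (hU (T η)).symm

/-- `L²` convergence implies convergence in distribution, and the exponential is a bounded
continuous test function. -/
theorem tendsto_integral_exp_of_tendsto_Lp {Ω ι : Type*} [MeasurableSpace Ω] {μ : Measure Ω}
    [IsProbabilityMeasure μ] {l : Filter ι} [l.IsCountablyGenerated] [l.NeBot] {Y : ι → Lp ℝ 2 μ}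
    {Z : Lp ℝ 2 μ} (h : Tendsto Y l (𝓝 Z)) (t : ℝ) :
    Tendsto (fun i => ∫ ω, Complex.exp (t * Y i ω * Complex.I) ∂μ) l
      (𝓝 (∫ ω, Complex.exp (t * Z ω * Complex.I) ∂μ)) := by
  have h1 := (tendstoInMeasure_of_tendsto_Lp h).tendstoInDistribution
    fun i => (Lp.stronglyMeasurable (Y i)).measurable.aemeasurable
  have h2 := (ProbabilityMeasure.tendsto_iff_forall_integral_rclike_tendsto ℂ).1 h1.tendsto
    (BoundedContinuousFunction.innerProbChar t)
  have h3 (W : Lp ℝ 2 μ) : ∫ x, BoundedContinuousFunction.innerProbChar t x ∂(μ.map W)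
      = ∫ ω, Complex.exp (t * W ω * Complex.I) ∂μ := by
    rw [← charFun_eq_integral_innerProbChar, charFun_apply_real,
      integral_map (Lp.stronglyMeasurable W).measurable.aemeasurable]
    exact (by fun_prop)
  simp only [← h3]
  exact h2

/-- If the characteristic function of `β` vanishes at `2 π η(g₀)`, then the integral of
`exp (2 π i T(η))` vanishes. -/
theorem integral_exp_toLp_eq_zero [Countable G]
    {T : EllTwo G →L[ℝ] Lp ℝ 2 (bernoulli G β)}
    (hT : open Classical in ∀ g, T (lp.single 2 g (1 : ℝ)) =ᵐ[bernoulli G β]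
        fun b => (b g : ℝ)) (η : EllTwo G) (t : ℝ) (g₀ : G)
    (hg₀ : ∫ x : ℤ, Complex.exp (t * η g₀ * x * Complex.I) ∂β = 0) :
    ∫ b, Complex.exp (t * T η b * Complex.I) ∂(bernoulli G β) = 0 := by
  classical
  have h1 : Tendsto (fun s : Finset G => T (∑ h ∈ s, η h • lp.single 2 h (1 : ℝ))) atTop
      (𝓝 (T η)) := by
    have h2 := lp.hasSum_single (by norm_num : (2 : ENNReal) ≠ ⊤) η
    have h4 (h : G) : (lp.single 2 h (η h) : EllTwo G) = η h • lp.single 2 h (1 : ℝ) := by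
      rw [← lp.single_smul]; simp
    simp_rw [h4] at h2
    exact (T.continuous.tendsto _).comp h2
  refine tendsto_nhds_unique (tendsto_integral_exp_of_tendsto_Lp h1 t) ?_
  refine tendsto_const_nhds.congr' ?_
  -- As soon as `s` contains `g₀`, the integral is a product with a zero factor.
  filter_upwards [eventually_ge_atTop {g₀}] with s hs
  have hind : iIndepFun (fun (g : G) (b : G → ℤ) => η g * (b g : ℝ)) (bernoulli G β) :=
    iIndepFun_infinitePi (X := fun g (n : ℤ) => η g * (n : ℝ)) fun _ => by fun_prop
  have hmeas (g : G) : Measurable fun b : G → ℤ => η g * (b g : ℝ) :=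
    (measurable_eval_intCast g).const_mul _
  have h5 := congrFun ((hind.restrict s).charFun_map_fun_finsetSum_eq_prod
    fun g _ => (hmeas g).aemeasurable) t
  have h6 : ∫ b, Complex.exp (t * T (∑ h ∈ s, η h • lp.single 2 h (1 : ℝ)) b * Complex.I)
        ∂(bernoulli G β)
      = charFun ((bernoulli G β).map fun b => ∑ h ∈ s, η h * b h) t := by
    rw [charFun_apply_real, integral_map
      (Finset.measurable_fun_sum s fun g _ => hmeas g).aemeasurable (by fun_prop)]
    refine integral_congr_ae ?_
    filter_upwards [toLp_sum_single hT s η] with b hb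
    rw [hb]
  rw [h6, h5, Finset.prod_apply]
  refine (Finset.prod_eq_zero (hs (Finset.mem_singleton_self g₀)) ?_).symm
  rw [charFun_apply_real, integral_map (hmeas g₀).aemeasurable (by fun_prop), ← hg₀,
    ← integral_bernoulli_eval β g₀]
  refine integral_congr_ae (ae_of_all _ fun b => ?_)
  push_cast
  simp only [mul_assoc]

end

/-! ### Characters and Haar measure of `X_f`. -/

section

variable {G : Type*} [Group G]

instance [Countable G] : Countable (MonoidAlgebra ℤ G) :=
  (MonoidAlgebra.coeff_injective (R := ℤ) (M := G)).countable

theorem isClosedEmbedding_coe_dualGroup (f : MonoidAlgebra ℤ G) :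
    IsClosedEmbedding ((⇑) : DualGroup f → CyclicModule f → UnitAddCircle) :=
  ContinuousAddMonoidHom.isClosedEmbedding_coe

instance [Countable G] (f : MonoidAlgebra ℤ G) : Countable (CyclicModule f) :=
  (Submodule.Quotient.mk_surjective _).countable

instance [Countable G] (f : MonoidAlgebra ℤ G) : PolishSpace (DualGroup f) :=
  (isClosedEmbedding_coe_dualGroup f).polishSpace

theorem continuous_eval_dualGroup (f : MonoidAlgebra ℤ G) (x : CyclicModule f) :
    Continuous fun χ : DualGroup f => χ x :=
  (continuous_apply x).comp (isClosedEmbedding_coe_dualGroup f).continuous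

theorem measurable_dualGroup_iff [Countable G] (f : MonoidAlgebra ℤ G) {Ω : Type*}
    [MeasurableSpace Ω] (φ : Ω → DualGroup f) :
    Measurable φ ↔ ∀ x, Measurable fun ω => φ ω x := by
  rw [← (isClosedEmbedding_coe_dualGroup f).measurableEmbedding.measurable_comp_iff,
    measurable_pi_iff]
  rfl

/-- Evaluation at `x ∈ ℤ(G)/ℤ(G)f`, as a character of `X_f`. -/
def evalChar (f : MonoidAlgebra ℤ G) (x : CyclicModule f) : DualGroup f →ᵇ ℂ :=
  BoundedContinuousFunction.mkOfCompact
    ⟨fun χ => ((χ x).toCircle : ℂ), by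
      have := continuous_eval_dualGroup f x
      have := AddCircle.continuous_toCircle (T := (1 : ℝ))
      fun_prop⟩

@[simp]
theorem evalChar_apply (f : MonoidAlgebra ℤ G) (x : CyclicModule f) (χ : DualGroup f) :
    evalChar f x χ = ((χ x).toCircle : ℂ) := rfl

theorem evalChar_zero (f : MonoidAlgebra ℤ G) : evalChar f 0 = 1 := by
  ext χ; simp

theorem evalChar_add (f : MonoidAlgebra ℤ G) (x y : CyclicModule f) :
    evalChar f (x + y) = evalChar f x * evalChar f y := by
  ext χ; simp [AddCircle.toCircle_add]

theorem evalChar_neg (f : MonoidAlgebra ℤ G) (x : CyclicModule f) :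
    evalChar f (-x) = star (evalChar f x) := by
  ext χ
  rw [evalChar_apply, map_neg, AddCircle.toCircle_neg, Circle.coe_inv_eq_conj]
  rfl

/-- The algebra of trigonometric polynomials on `X_f`. -/
def evalCharSubalgebra (f : MonoidAlgebra ℤ G) : StarSubalgebra ℂ (DualGroup f →ᵇ ℂ) :=
  { Algebra.adjoin ℂ (Set.range (evalChar f)) with
    star_mem' := by
      change Algebra.adjoin ℂ (Set.range (evalChar f)) ≤
        star (Algebra.adjoin ℂ (Set.range (evalChar f)))
      refine Algebra.adjoin_le ?_
      rintro _ ⟨x, rfl⟩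
      exact Algebra.subset_adjoin ⟨-x, evalChar_neg f x⟩ }

/-- The characters are closed under multiplication, so the algebra they generate is just their
linear span. -/
theorem mem_span_of_mem_evalCharSubalgebra (f : MonoidAlgebra ℤ G) {F : DualGroup f →ᵇ ℂ}
    (hF : F ∈ evalCharSubalgebra f) : F ∈ Submodule.span ℂ (Set.range (evalChar f)) := by
  let S : Submonoid (DualGroup f →ᵇ ℂ) :=
    { carrier := Set.range (evalChar f)
      mul_mem' := by
        rintro _ _ ⟨x, rfl⟩ ⟨y, rfl⟩
        exact ⟨x + y, evalChar_add f x y⟩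
      one_mem' := ⟨0, evalChar_zero f⟩ }
  have h : F ∈ Subalgebra.toSubmodule (Algebra.adjoin ℂ (S : Set (DualGroup f →ᵇ ℂ))) := hF
  rwa [Algebra.adjoin_eq_span, Submonoid.closure_eq] at h

/-- Trigonometric polynomials form a star algebra separating points, and such an algebra determines
a finite measure on a Polish space. -/
theorem ext_of_integral_evalChar_eq [Countable G] (f : MonoidAlgebra ℤ G)
    (μ ν : Measure (DualGroup f)) [IsFiniteMeasure μ] [IsFiniteMeasure ν]
    (h : ∀ x, ∫ χ, evalChar f x χ ∂μ = ∫ χ, evalChar f x χ ∂ν) : μ = ν := by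
  refine ext_of_forall_mem_subalgebra_integral_eq_of_polish (𝕜 := ℂ)
    (A := evalCharSubalgebra f) ?_ ?_
  · intro χ ψ hne
    obtain ⟨x, hx⟩ : ∃ x, χ x ≠ ψ x := by
      by_contra! hall
      exact hne (ContinuousAddMonoidHom.ext hall)
    refine ⟨_, ⟨(evalChar f x).toContinuousMap,
      ⟨evalChar f x, Algebra.subset_adjoin ⟨x, rfl⟩, rfl⟩, rfl⟩, fun heq => hx ?_⟩
    exact AddCircle.injective_toCircle one_ne_zero (Circle.coe_injective heq)
  · intro F hF
    have hspan := mem_span_of_mem_evalCharSubalgebra f hF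
    clear hF
    induction hspan using Submodule.span_induction with
    | mem F hF => obtain ⟨x, rfl⟩ := hF; exact h x
    | zero => simp
    | add F₁ F₂ _ _ h₁ h₂ =>
      simp only [BoundedContinuousFunction.coe_add, Pi.add_apply]
      rw [integral_add (F₁.integrable μ) (F₂.integrable μ),
        integral_add (F₁.integrable ν) (F₂.integrable ν), h₁, h₂]
    | smul c F _ hF =>
      simp only [BoundedContinuousFunction.coe_smul]
      rw [integral_smul, integral_smul, hF]

/-- A probability measure on `X_f` under which all nontrivial characters have integral zero is the
Haar measure. -/
theorem eq_haarX_of_integral_evalChar_eq_zero [Countable G] (f : MonoidAlgebra ℤ G)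
    (μ : Measure (DualGroup f)) [IsProbabilityMeasure μ]
    (h : ∀ x, x ≠ 0 → ∫ χ, evalChar f x χ ∂μ = 0) : μ = haarX f := by
  -- Translation by `ψ` multiplies each Fourier coefficient by a character value; the nontrivial
  -- ones are zero and the trivial one is the total mass.
  have hinv : μ.IsAddLeftInvariant := by
    refine ⟨fun ψ => ?_⟩
    have hm : Measurable fun χ : DualGroup f => ψ + χ := measurable_const_add ψ
    have := Measure.isProbabilityMeasure_map (μ := μ) hm.aemeasurable
    refine ext_of_integral_evalChar_eq f _ _ fun x => ?_
    rw [integral_map hm.aemeasurable (evalChar f x).continuous.aestronglyMeasurable]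
    rcases eq_or_ne x 0 with rfl | hx
    · simp
    · have h1 (χ : DualGroup f) : evalChar f x (ψ + χ) = evalChar f x ψ * evalChar f x χ := by
        simp [AddCircle.toCircle_add]
      simp_rw [h1]
      rw [integral_const_mul, h x hx, mul_zero]
  have h1 : IsProbabilityMeasure (haarX f) := ⟨Measure.addHaarMeasure_self⟩
  have h2 : (haarX f).IsAddHaarMeasure := by unfold haarX; infer_instance
  have h3 : μ.IsAddHaarMeasure := Measure.isAddHaarMeasure_of_isCompact_nonempty_interior μ
    Set.univ isCompact_univ (by simp) (by simp) (by simp)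
  exact Measure.isAddHaarMeasure_eq_of_isProbabilityMeasure _ _

end

/-! ### The factor map. -/

section

variable {G : Type*} [Group G]

/-- The reduction modulo one of the random variable attached to `α ξ`. -/
def homoclinicSum {β : Measure ℤ} (T : EllTwo G →L[ℝ] Lp ℝ 2 (bernoulli G β)) (ξ : EllTwo G)
    (α : MonoidAlgebra ℤ G) (b : G → ℤ) : UnitAddCircle :=
  ((T (convLeftL α ξ) b : ℝ) : UnitAddCircle)

section

variable {β : Measure ℤ} {T : EllTwo G →L[ℝ] Lp ℝ 2 (bernoulli G β)} {ξ : EllTwo G}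
  {f : MonoidAlgebra ℤ G}

theorem measurable_homoclinicSum (α : MonoidAlgebra ℤ G) :
    Measurable (homoclinicSum T ξ α) :=
  AddCircle.measurable_mk'.comp (Lp.stronglyMeasurable _).measurable

theorem homoclinicSum_add (α α' : MonoidAlgebra ℤ G) :
    ∀ᵐ b ∂(bernoulli G β),
      homoclinicSum T ξ (α + α') b = homoclinicSum T ξ α b + homoclinicSum T ξ α' b := by
  filter_upwards [Lp.coeFn_add (T (convLeftL α ξ)) (T (convLeftL α' ξ))] with b hb
  rw [homoclinicSum, convLeftL_add, map_add, hb, Pi.add_apply, AddCircle.coe_add]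
  rfl

open Classical in
theorem homoclinicSum_eq_zero
    (hT : ∀ g, T (lp.single 2 g (1 : ℝ)) =ᵐ[bernoulli G β] fun b => (b g : ℝ))
    (hξ : convLeftL f ξ = lp.single 2 1 (1 : ℝ)) {α : MonoidAlgebra ℤ G}
    (hα : α ∈ Ideal.span {f}) :
    ∀ᵐ b ∂(bernoulli G β), homoclinicSum T ξ α b = 0 := by
  obtain ⟨a, rfl⟩ := Submodule.mem_span_singleton.1 hα
  have h : convLeftL (a • f) ξ
      = ∑ h ∈ a.coeff.support, (a.coeff h : ℝ) • lp.single 2 h (1 : ℝ) := by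
    rw [smul_eq_mul, convLeftL_mul, hξ, convLeftL_apply_single]
  filter_upwards [toLp_sum_single hT a.coeff.support fun h => (a.coeff h : ℝ)] with b hb
  rw [homoclinicSum, h, hb, AddCircle.coe_eq_zero_iff]
  exact ⟨∑ h ∈ a.coeff.support, a.coeff h * b h, by simp⟩

open Classical in
theorem homoclinicSum_congr
    (hT : ∀ g, T (lp.single 2 g (1 : ℝ)) =ᵐ[bernoulli G β] fun b => (b g : ℝ))
    (hξ : convLeftL f ξ = lp.single 2 1 (1 : ℝ)) {α α' : MonoidAlgebra ℤ G}
    (hα : (Submodule.Quotient.mk α : CyclicModule f) = Submodule.Quotient.mk α') :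
    ∀ᵐ b ∂(bernoulli G β), homoclinicSum T ξ α b = homoclinicSum T ξ α' b := by
  have h := (Submodule.Quotient.eq _).1 hα
  filter_upwards [homoclinicSum_eq_zero hT hξ h, homoclinicSum_add (T := T) (ξ := ξ) (α - α') α']
    with b h1 h2
  rw [← sub_add_cancel α α', h2, h1, zero_add]

open Classical in
/-- The homomorphism `α ↦ T(α ξ) mod 1` as a random point of `X_f`. -/
def homoclinicMap (T : EllTwo G →L[ℝ] Lp ℝ 2 (bernoulli G β)) (ξ : EllTwo G)
    (f : MonoidAlgebra ℤ G) (b : G → ℤ) : DualGroup f :=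
  -- `T(α ξ)` is defined only almost everywhere, so additivity on chosen representatives may fail on
  -- a null set; there the value is `0`.
  if h : ∀ x y : CyclicModule f, homoclinicSum T ξ (x + y).out b
      = homoclinicSum T ξ x.out b + homoclinicSum T ξ y.out b then
    { AddMonoidHom.mk' (fun x : CyclicModule f => homoclinicSum T ξ x.out b) h with
      continuous_toFun := continuous_of_discreteTopology }
  else 0

theorem measurable_homoclinicMap [Countable G] : Measurable (homoclinicMap T ξ f) := by
  classical
  rw [measurable_dualGroup_iff]
  intro x
  have h1 : MeasurableSet {b : G → ℤ | ∀ x y : CyclicModule f, homoclinicSum T ξ (x + y).out b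
      = homoclinicSum T ξ x.out b + homoclinicSum T ξ y.out b} := by
    simp only [Set.ofPred_forall]
    exact MeasurableSet.iInter fun x => MeasurableSet.iInter fun y =>
      measurableSet_eq_fun (measurable_homoclinicSum _)
        ((measurable_homoclinicSum _).add (measurable_homoclinicSum _))
  have h2 : (fun b => homoclinicMap T ξ f b x) = fun b =>
      if ∀ x y : CyclicModule f, homoclinicSum T ξ (x + y).out b
        = homoclinicSum T ξ x.out b + homoclinicSum T ξ y.out b then
      homoclinicSum T ξ x.out b else 0 := by
    ext b
    unfold homoclinicMap
    split_ifs <;> rfl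
  rw [h2]
  exact Measurable.ite h1 (measurable_homoclinicSum _) measurable_const

open Classical in
theorem homoclinicMap_apply_mk [Countable G]
    (hT : ∀ g, T (lp.single 2 g (1 : ℝ)) =ᵐ[bernoulli G β] fun b => (b g : ℝ))
    (hξ : convLeftL f ξ = lp.single 2 1 (1 : ℝ)) :
    ∀ᵐ b ∂(bernoulli G β), ∀ α : MonoidAlgebra ℤ G,
      homoclinicMap T ξ f b (Submodule.Quotient.mk α) = homoclinicSum T ξ α b := by
  have h1 : ∀ᵐ b ∂(bernoulli G β), ∀ α : MonoidAlgebra ℤ G,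
      homoclinicSum T ξ (Submodule.Quotient.mk α : CyclicModule f).out b
        = homoclinicSum T ξ α b :=
    ae_all_iff.2 fun α => homoclinicSum_congr hT hξ (Quotient.out_eq _)
  have h2 : ∀ᵐ b ∂(bernoulli G β), ∀ α α' : MonoidAlgebra ℤ G,
      homoclinicSum T ξ (α + α') b = homoclinicSum T ξ α b + homoclinicSum T ξ α' b :=
    ae_all_iff.2 fun α => ae_all_iff.2 fun α' => homoclinicSum_add α α'
  filter_upwards [h1, h2] with b hb1 hb2 α
  have h3 : ∀ x y : CyclicModule f, homoclinicSum T ξ (x + y).out b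
      = homoclinicSum T ξ x.out b + homoclinicSum T ξ y.out b := by
    intro x y
    obtain ⟨a, rfl⟩ := Submodule.Quotient.mk_surjective _ x
    obtain ⟨c, rfl⟩ := Submodule.Quotient.mk_surjective _ y
    rw [← Submodule.Quotient.mk_add, hb1, hb1, hb1, hb2]
  rw [homoclinicMap, dif_pos h3]
  exact hb1 α

open Classical in
theorem integral_evalChar_homoclinicMap [Countable G]
    (hT : ∀ g, T (lp.single 2 g (1 : ℝ)) =ᵐ[bernoulli G β] fun b => (b g : ℝ))
    (hξ : convLeftL f ξ = lp.single 2 1 (1 : ℝ)) (α : MonoidAlgebra ℤ G) :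
    ∫ χ, evalChar f (Submodule.Quotient.mk α) χ ∂((bernoulli G β).map (homoclinicMap T ξ f))
      = ∫ b, Complex.exp ((2 * Real.pi : ℝ) * T (convLeftL α ξ) b * Complex.I)
          ∂(bernoulli G β) := by
  rw [integral_map measurable_homoclinicMap.aemeasurable
    (evalChar f _).continuous.aestronglyMeasurable]
  refine integral_congr_ae ?_
  filter_upwards [homoclinicMap_apply_mk hT hξ] with b hb
  rw [evalChar_apply, hb, homoclinicSum, AddCircle.toCircle_apply_mk, Circle.coe_exp]
  simp

variable [IsProbabilityMeasure β]

open Classical in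
theorem homoclinicMap_shift [Countable G]
    (hT : ∀ g, T (lp.single 2 g (1 : ℝ)) =ᵐ[bernoulli G β] fun b => (b g : ℝ))
    (hξ : convLeftL f ξ = lp.single 2 1 (1 : ℝ)) (g : G) :
    ∀ᵐ b ∂(bernoulli G β), homoclinicMap T ξ f (shift g b) = g • homoclinicMap T ξ f b := by
  have h1 := homoclinicMap_apply_mk hT hξ
  have h2 : ∀ᵐ b ∂(bernoulli G β), ∀ α : MonoidAlgebra ℤ G,
      T (convLeftL α ξ) (shift g b) = T (permute (Equiv.mulLeft g) (convLeftL α ξ)) b :=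
    ae_all_iff.2 fun α => toLp_shift hT g _
  filter_upwards [h1, (measurePreserving_shift β g).quasiMeasurePreserving.ae h1, h2]
    with b hb hgb hs
  refine ContinuousAddMonoidHom.ext fun x => ?_
  obtain ⟨α, rfl⟩ := Submodule.Quotient.mk_surjective _ x
  change _ = homoclinicMap T ξ f b (MonoidAlgebra.of ℤ G g⁻¹ • Submodule.Quotient.mk α)
  -- `permute (Equiv.mulLeft g)` is left convolution by `g⁻¹`, which matches `(g χ)(x) = χ(g⁻¹ x)`.
  rw [← Submodule.Quotient.mk_smul, hb, hgb, homoclinicSum, hs, homoclinicSum, smul_eq_mul,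
    convLeftL_mul, MonoidAlgebra.of_apply, convLeftL_single]
  simp

end

end

end

end AlgebraicAction

theorem mainTheorem10 {G : Type*} [Group G] [Countable G] (f : MonoidAlgebra ℤ G) (ξ : G → ℝ)
    (hξ : AlgebraicAction.IsL2FormalInverse f ξ)
    (hM : ∃ M : ℕ, ∀ α : MonoidAlgebra ℤ G, α ∉ Ideal.span {f} →
      ∃ g₀ : G, ∃ k : ℕ, 1 ≤ k ∧ k ≤ M ∧
        (∃ n : ℤ, AlgebraicAction.convLeft α ξ g₀ = (n : ℝ) / (k : ℝ)) ∧
        ¬ ∃ n : ℤ, AlgebraicAction.convLeft α ξ g₀ = (n : ℝ)) :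
    AlgebraicAction.IsFactorOfBernoulli G (AlgebraicAction.DualGroup f)
      (AlgebraicAction.haarX f) := by
  open AlgebraicAction in
  classical
  obtain ⟨M, hM⟩ := hM
  obtain ⟨β, hβ, h2, h0, hne, hchar⟩ := exists_measure_int_charFun_eq_zero M
  obtain ⟨T, hT⟩ := exists_ellTwo_toLp (ι := G) h2 h0 hne
  let ζ : EllTwo G := ⟨ξ, hξ.1⟩
  have hζ : convLeftL f ζ = lp.single 2 1 (1 : ℝ) := by
    refine convLeftL_eq_single_of_convRightL_eq_single f ζ ?_
    ext g
    rw [coe_convRightL, lp.single_apply]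
    refine (congrFun hξ.2 g).trans ?_
    simp only [Pi.single_apply]
  refine ⟨ℤ, inferInstance, inferInstance, β, hβ, homoclinicMap T ζ f,
    ⟨measurable_homoclinicMap, ?_⟩, homoclinicMap_shift hT hζ⟩
  have := Measure.isProbabilityMeasure_map (μ := bernoulli G β)
    (measurable_homoclinicMap (T := T) (ξ := ζ) (f := f)).aemeasurable
  refine eq_haarX_of_integral_evalChar_eq_zero f _ fun x hx => ?_
  obtain ⟨α, rfl⟩ := Submodule.Quotient.mk_surjective _ x
  rw [integral_evalChar_homoclinicMap hT hζ]
  obtain ⟨g₀, k, hk1, hkM, ⟨n, hn⟩, hint⟩ :=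
    hM α fun hα => hx ((Submodule.Quotient.mk_eq_zero _).2 hα)
  refine integral_exp_toLp_eq_zero hT _ _ g₀ ?_
  have h3 : convLeftL α ζ g₀ = n / k := by rw [coe_convLeftL]; exact hn
  rw [hn] at hint
  rw [h3, ← hchar k hk1 hkM n hint]
  simp
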